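/- Let $\alpha\in(0,1)$ and let ${}^C\!D^\alpha_{0,+}f(t)=\frac1{\Gamma(1-\alpha)}\int_0^t\frac{\dot f(\tau)}{(t-\tau)^\alpha}\,d\tau$ be the left Caputo derivative. Let $T_\star\in(0,+\infty]$ and let $v:[0,T_\star)\to\mathbb R$ be such that $u(x,t):=-x\,v(t)$ solves the time-fractional Burgers equation $${}^C\!D^\alpha_{0,+}u(x,t)+u(x,t)\,\partial_xu(x,t)=0\quad\text{for all }x\in\mathbb R,\ t\in(0,T_\star),\qquad u(x,0)=-x$$ (equivalently, ${}^C\!D^\alpha_{0,+}v=v^2$ in $(0,T_\star)$ and $v(0)=1$), where $v$ is continuous on $[0,T_\star)$, differentiable on $(0,T_\star)$, and the integrals defining its Caputo derivative converge absolutely. Suppose that $T_\star$ is the blow-up time of $u$, that is, either $T_\star=+\infty$ (no blow-up occurs), or there is a sequence $t_n\nearrow T_\star$ along which $u(x,t_n)\to+\infty$ for every $x<0$ and $u(x,t_n)\to-\infty$ for every $x>0$. Then $T_\star$ is finite and $$T_\star\le\left(\frac1{\Gamma(2-\alpha)}\right)^{1/\alpha}.$$ In particular, for all $\alpha\in(0,1)$,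 $$T_\star\le e^{1-\gamma}=1.52620511\dots,$$ where $\gamma$ is the Euler--Mascheroni constant. -/

import Mathlib

open Filter Topology MeasureTheory

/-- The left Caputo derivative of order `α ∈ (0,1)` with initial time `t₀`,
`(1 / Γ(1-α)) ∫_{t₀}^t f'(τ) / (t-τ)^α dτ`. -/
noncomputable def caputoDeriv (α t₀ : ℝ) (f : ℝ → ℝ) (t : ℝ) : ℝ :=
  1 / Real.Gamma (1 - α) * ∫ τ in t₀..t, deriv f τ / (t - τ) ^ α

/-- `u : ℝ × [0,T) → ℝ` (space variable first) solves the time-fractional Burgers equation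
`ᶜD^α_{0,+} u + u ∂ₓu = 0` on `ℝ × (0,T)` with initial datum `u₀`, where `T ∈ (0,∞]`.
The first five fields say that the initial condition is attained continuously and that all the
derivatives and integrals appearing in the equation exist. Values of `u` at times outside
`[0,T)` are irrelevant. -/
structure IsFractionalBurgersSolution (α : ℝ) (T : EReal) (u₀ : ℝ → ℝ) (u : ℝ → ℝ → ℝ) :
    Prop where
  initial : ∀ x, u x 0 = u₀ x
  continuous_time : ∀ x, ContinuousOn (u x) {t : ℝ | 0 ≤ t ∧ (t : EReal) < T}
  differentiable_time : ∀ x, ∀ t : ℝ, 0 < t → (t : EReal) < T → DifferentiableAt ℝ (u x) t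
  differentiable_space : ∀ x, ∀ t : ℝ, 0 < t → (t : EReal) < T →
    DifferentiableAt ℝ (fun y => u y t) x
  integrable_memory : ∀ x, ∀ t : ℝ, 0 < t → (t : EReal) < T →
    IntervalIntegrable (fun τ => deriv (u x) τ / (t - τ) ^ α) volume 0 t
  equation : ∀ x, ∀ t : ℝ, 0 < t → (t : EReal) < T →
    caputoDeriv α 0 (u x) t + u x t * deriv (fun y => u y t) x = 0

/-- Along some sequence of times `tₙ ↗ T` in `[0,T)`, `u(x,tₙ) → +∞` for every `x < 0` and
`u(x,tₙ) → -∞` for every `x > 0`. -/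
def BlowsUpAt (T : EReal) (u : ℝ → ℝ → ℝ) : Prop :=
  ∃ t : ℕ → ℝ, StrictMono t ∧ (∀ n, 0 ≤ t n ∧ (t n : EReal) < T) ∧
    Tendsto (fun n => (t n : EReal)) atTop (𝓝 T) ∧
    (∀ x < 0, Tendsto (fun n => u x (t n)) atTop atTop) ∧
    (∀ x > 0, Tendsto (fun n => u x (t n)) atTop atBot)

/-- The function `u(x,t) = -x v(t)` solves the time-fractional Burgers equation on
`ℝ × (0,T)` with initial datum `u(x,0) = -x`, and `T ∈ (0,∞]` is its blow-up time:
either `T = ∞` (no blow-up occurs) or the solution becomes singular at the finite time `T`. -/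
structure IsSingularSolutionWithBlowUpTime (α : ℝ) (T : EReal) (v : ℝ → ℝ) : Prop where
  pos : 0 < T
  solution : IsFractionalBurgersSolution α T (fun x => -x) (fun x t => -x * v t)
  blowUp : T = ⊤ ∨ BlowsUpAt T (fun x t => -x * v t)

/-! At `x = -1` the equation reads `D^α v = v²`, `v 0 = 1`. If a solution lived past some `T >
Γ(2-α)^(-1/α)`, it could be compared with `w t = c T / (T - t)`, where `c = 1 / (T^α Γ(2-α)) < 1`.
Bounding `w'` on `[0,t]` by its final value gives `D^α w ≤ w²`. Since `w 0 < v 0` and `w` blows up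
at `T` while `v` stays bounded on `[0,T]`, there is a first contact time. There the nonlocal
derivative of `v - w` is strictly negative (`integral_deriv_div_rpow_le`), although the equation
forces `D^α v = w² ≥ D^α w`. The uniform bound is convexity of `log Γ` at `2`, and its decimals come
from Euler–Maclaurin bounds on `γ`. -/

/-! ### Numerical bounds for the Euler–Mascheroni constant -/

/-- With `y = 1/m` this is the trapezoidal rule for `∫ 1/x` on `[m, m+1]` with its first
Euler–Maclaurin correction. The difference vanishes at `0` and has an explicit nonnegative
derivative. -/
theorem le_log_one_add_of_nonneg {y : ℝ} (hy : 0 ≤ y) :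
    (y / (1 + y) + y) / 2 + ((y / (1 + y)) ^ 2 - y ^ 2) / 12 ≤ Real.log (1 + y) := by
  let f : ℝ → ℝ := fun y =>
    Real.log (1 + y) - ((y / (1 + y) + y) / 2 + ((y / (1 + y)) ^ 2 - y ^ 2) / 12)
  have hd : ∀ x : ℝ, 0 ≤ x → HasDerivAt f (x ^ 4 / (6 * (1 + x) ^ 3)) x := by
    intro x hx
    have hx1 : 1 + x ≠ 0 := by positivity
    have h1 : HasDerivAt (fun y : ℝ => 1 + y) 1 x := (hasDerivAt_id x).const_add 1
    have h2 := (hasDerivAt_id x).div h1 hx1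
    have h3 := (h1.log hx1).sub (((h2.add (hasDerivAt_id x)).div_const 2).add
      (((h2.pow 2).sub ((hasDerivAt_id x).pow 2)).div_const 12))
    refine h3.congr_deriv ?_
    simp
    field_simp
    ring
  have hm : MonotoneOn f (Set.Ici 0) := by
    refine monotoneOn_of_deriv_nonneg (convex_Ici 0)
      (fun x hx => (hd x hx).continuousAt.continuousWithinAt)
      (fun x hx => (hd x (interior_subset hx)).differentiableAt.differentiableWithinAt) ?_
    intro x hx
    have hx0 : (0 : ℝ) ≤ x := interior_subset hx
    rw [(hd x hx0).deriv]
    positivity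
  have := hm Set.self_mem_Ici hy hy
  simp only [f] at this
  norm_num at this
  linarith

theorem log_one_add_le_of_nonneg {y : ℝ} (hy : 0 ≤ y) :
    Real.log (1 + y) ≤ (y / (1 + y) + y) / 2 + ((y / (1 + y)) ^ 2 - y ^ 2) / 12
      - ((y / (1 + y)) ^ 4 - y ^ 4) / 120 := by
  let f : ℝ → ℝ := fun y => (y / (1 + y) + y) / 2 + ((y / (1 + y)) ^ 2 - y ^ 2) / 12
      - ((y / (1 + y)) ^ 4 - y ^ 4) / 120 - Real.log (1 + y)
  have hd : ∀ x : ℝ, 0 ≤ x →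
      HasDerivAt f (x ^ 3 * (5 * x ^ 3 + 5 * x ^ 4 + x ^ 5) / (30 * (1 + x) ^ 5)) x := by
    intro x hx
    have hx1 : 1 + x ≠ 0 := by positivity
    have h1 : HasDerivAt (fun y : ℝ => 1 + y) 1 x := (hasDerivAt_id x).const_add 1
    have h2 := (hasDerivAt_id x).div h1 hx1
    have h3 := ((((h2.add (hasDerivAt_id x)).div_const 2).add
      (((h2.pow 2).sub ((hasDerivAt_id x).pow 2)).div_const 12)).sub
      (((h2.pow 4).sub ((hasDerivAt_id x).pow 4)).div_const 120)).sub (h1.log hx1)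
    refine h3.congr_deriv ?_
    simp
    field_simp
    ring
  have hm : MonotoneOn f (Set.Ici 0) := by
    refine monotoneOn_of_deriv_nonneg (convex_Ici 0)
      (fun x hx => (hd x hx).continuousAt.continuousWithinAt)
      (fun x hx => (hd x (interior_subset hx)).differentiableAt.differentiableWithinAt) ?_
    intro x hx
    have hx0 : (0 : ℝ) ≤ x := interior_subset hx
    rw [(hd x hx0).deriv]
    positivity
  have := hm Set.self_mem_Ici hy hy
  simp only [f] at this
  norm_num at this
  linarith

theorem log_succ_sub_log (n : ℕ) :
    Real.log ((n + 1 : ℕ) + 1) - Real.log (n + 1) = Real.log (1 + 1 / ((n : ℝ) + 1)) := by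
  rw [← Real.log_div (by positivity) (by positivity)]
  congr 1
  push_cast
  field_simp

theorem tendsto_const_div_succ_pow (c : ℝ) (k : ℕ) (hk : k ≠ 0) :
    Tendsto (fun n : ℕ => c * (1 / ((n : ℝ) + 1)) ^ k) atTop (𝓝 0) := by
  simpa [hk] using (tendsto_one_div_add_atTop_nhds_zero_nat (𝕜 := ℝ)).pow k |>.const_mul c

theorem tendsto_harmonic_succ_sub_log_succ :
    Tendsto (fun n : ℕ => (harmonic (n + 1) : ℝ) - Real.log (n + 1)) atTop
      (𝓝 Real.eulerMascheroniConstant) := by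
  have := Real.tendsto_harmonic_sub_log.comp (tendsto_add_atTop_nat 1)
  simpa [Function.comp_def] using this

/-- The logarithm inequality makes the corrected sequence decrease to its limit `γ`; one more
correction term makes it increase instead. -/
theorem eulerMascheroniConstant_le (n : ℕ) :
    Real.eulerMascheroniConstant ≤ harmonic (n + 1) - Real.log (n + 1)
      - 1 / 2 * (1 / ((n : ℝ) + 1)) ^ 1 + 1 / 12 * (1 / ((n : ℝ) + 1)) ^ 2 := by
  refine Antitone.le_of_tendsto (f := fun n : ℕ => (harmonic (n + 1) : ℝ) - Real.log (n + 1)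
      - 1 / 2 * (1 / ((n : ℝ) + 1)) ^ 1 + 1 / 12 * (1 / ((n : ℝ) + 1)) ^ 2)
    (antitone_nat_of_succ_le fun n => ?_) ?_ n
  · have h := le_log_one_add_of_nonneg (y := 1 / ((n : ℝ) + 1)) (by positivity)
    rw [← log_succ_sub_log] at h
    have e : (1 / ((n : ℝ) + 1)) / (1 + 1 / ((n : ℝ) + 1)) = 1 / ((n + 1 : ℕ) + 1) := by
      push_cast; field_simp
    rw [e] at h
    rw [harmonic_succ (n + 1)]
    push_cast at h ⊢
    rw [inv_eq_one_div]
    linarith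
  · simpa using (tendsto_harmonic_succ_sub_log_succ.sub
      (tendsto_const_div_succ_pow (1 / 2) 1 one_ne_zero)).add
      (tendsto_const_div_succ_pow (1 / 12) 2 two_ne_zero)

theorem le_eulerMascheroniConstant (n : ℕ) :
    harmonic (n + 1) - Real.log (n + 1) - 1 / 2 * (1 / ((n : ℝ) + 1)) ^ 1
      + 1 / 12 * (1 / ((n : ℝ) + 1)) ^ 2 - 1 / 120 * (1 / ((n : ℝ) + 1)) ^ 4
      ≤ Real.eulerMascheroniConstant := by
  refine Monotone.ge_of_tendsto (f := fun n : ℕ => (harmonic (n + 1) : ℝ) - Real.log (n + 1)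
      - 1 / 2 * (1 / ((n : ℝ) + 1)) ^ 1 + 1 / 12 * (1 / ((n : ℝ) + 1)) ^ 2
      - 1 / 120 * (1 / ((n : ℝ) + 1)) ^ 4)
    (monotone_nat_of_le_succ fun n => ?_) ?_ n
  · have h := log_one_add_le_of_nonneg (y := 1 / ((n : ℝ) + 1)) (by positivity)
    rw [← log_succ_sub_log] at h
    have e : (1 / ((n : ℝ) + 1)) / (1 + 1 / ((n : ℝ) + 1)) = 1 / ((n + 1 : ℕ) + 1) := by
      push_cast; field_simp
    rw [e] at h
    rw [harmonic_succ (n + 1)]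
    push_cast at h ⊢
    rw [inv_eq_one_div]
    linarith
  · simpa using ((tendsto_harmonic_succ_sub_log_succ.sub
      (tendsto_const_div_succ_pow (1 / 2) 1 one_ne_zero)).add
      (tendsto_const_div_succ_pow (1 / 12) 2 two_ne_zero)).sub
      (tendsto_const_div_succ_pow (1 / 120) 4 four_ne_zero)

theorem exp_one_sub_eulerMascheroniConstant_mem :
    Real.exp (1 - Real.eulerMascheroniConstant) ∈ Set.Ico (1.52620511 : ℝ) 1.52620512 := by
  -- Index 99 means `m = 100`: the two bounds differ by `10⁻⁸/120`, enough for eight decimals.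
  have h1 := eulerMascheroniConstant_le 99
  have h2 := le_eulerMascheroniConstant 99
  norm_num at h1 h2
  -- The term `log 100` exponentiates exactly; dividing the rest by 8 puts it in `[-1, 1]`, as
  -- `Real.exp_bound` requires.
  have e : ∀ x : ℝ, Real.exp (Real.log 100 + 8 * x) = 100 * Real.exp x ^ 8 := by
    intro x
    rw [Real.exp_add, Real.exp_log (by norm_num), ← Real.exp_nat_mul]
    norm_num
  constructor
  · have hb := Real.exp_bound (x := -0.52279823138) (by norm_num [abs_le]) (n := 14) (by norm_num)
    rw [abs_le] at hb
    norm_num [Finset.sum_range_succ, Nat.factorial] at hb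
    have h5 : (0.59285926728 : ℝ) ≤ Real.exp (-0.52279823138) := by
      norm_num
      linarith [hb.1]
    calc (1.52620511 : ℝ) ≤ 100 * 0.59285926728 ^ 8 := by norm_num
      _ ≤ 100 * Real.exp (-0.52279823138) ^ 8 := by gcongr
      _ = Real.exp (Real.log 100 + 8 * (-0.52279823138)) := (e _).symm
      _ ≤ _ := Real.exp_le_exp.2 (by linarith)
  · have hb := Real.exp_bound (x := -0.5227982313) (by norm_num [abs_le]) (n := 14) (by norm_num)
    rw [abs_le] at hb
    norm_num [Finset.sum_range_succ, Nat.factorial] at hb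
    have h5 : Real.exp (-0.5227982313) ≤ (0.5928592677 : ℝ) := by
      norm_num
      linarith [hb.2]
    calc _ ≤ Real.exp (Real.log 100 + 8 * (-0.5227982313)) := Real.exp_le_exp.2 (by linarith)
      _ = 100 * Real.exp (-0.5227982313) ^ 8 := e _
      _ ≤ 100 * 0.5928592677 ^ 8 := by gcongr
      _ < (1.52620512 : ℝ) := by norm_num

/-! ### Bound uniform in the order -/

/-- Since `log Γ(2) = 0`, the logarithm of the left side is the slope of the convex function `log Γ`
over `[2-α, 2]`, at most its derivative `1 - γ` at `2`. -/
theorem rpow_inv_Gamma_two_sub_le_exp {α : ℝ} (hα₀ : 0 < α) (hα₁ : α < 1) :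
    (1 / Real.Gamma (2 - α)) ^ (1 / α) ≤ Real.exp (1 - Real.eulerMascheroniConstant) := by
  have hΓ : 0 < Real.Gamma (2 - α) := Real.Gamma_pos_of_pos (by linarith)
  have hd : HasDerivAt (Real.log ∘ Real.Gamma) (1 - Real.eulerMascheroniConstant) 2 := by
    have h := Real.hasDerivAt_Gamma_nat 1
    norm_num at h
    have h2 := h.log (by norm_num [Real.Gamma_two])
    rw [Real.Gamma_two] at h2
    refine h2.congr_deriv ?_
    ring
  have h := Real.convexOn_log_Gamma.slope_le_of_hasDerivAt (x := 2 - α) (y := 2)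
    (Set.mem_Ioi.2 (by linarith)) (Set.mem_Ioi.2 (by norm_num)) (by linarith) hd
  rw [slope_def_field] at h
  simp only [Function.comp, Real.Gamma_two, Real.log_one, sub_sub_cancel] at h
  rw [Real.rpow_def_of_pos (by positivity), Real.exp_le_exp, one_div, Real.log_inv]
  calc _ = (0 - Real.log (Real.Gamma (2 - α))) / α := by ring
    _ ≤ _ := h

/-! ### Comparison principle and blow-up -/

/-- Integration by parts: the kernel increases in `τ` and `z ≥ 0`, so the integrand is at most the
derivative of `z τ / (t₀ - τ)^α`. The kernel is singular at `t₀`, so the estimate is made up to `s <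
t₀` before `s → t₀`. -/
theorem integral_deriv_div_rpow_le {α t₀ : ℝ} {z z' : ℝ → ℝ} (hα₀ : 0 < α) (hα₁ : α < 1)
    (ht₀ : 0 < t₀) (hc : ContinuousOn z (Set.Icc 0 t₀))
    (hd : ∀ t ∈ Set.Ioo 0 t₀, HasDerivAt z (z' t) t) (hd₀ : DifferentiableAt ℝ z t₀)
    (hz : ∀ t ∈ Set.Ioo 0 t₀, 0 ≤ z t) (hz₀ : z t₀ = 0)
    (hi : IntervalIntegrable (fun τ => z' τ / (t₀ - τ) ^ α) volume 0 t₀) :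
    ∫ τ in 0..t₀, z' τ / (t₀ - τ) ^ α ≤ -(z 0 / t₀ ^ α) := by
  have hs : ∀ s ∈ Set.Ioo 0 t₀, ∫ τ in 0..s, z' τ / (t₀ - τ) ^ α
      ≤ z s / (t₀ - s) ^ α - z 0 / t₀ ^ α := by
    intro s hs
    have hk : ∀ τ < t₀, HasDerivAt (fun τ => (t₀ - τ) ^ α) (-1 * α * (t₀ - τ) ^ (α - 1)) τ :=
      fun τ hτ => ((hasDerivAt_id τ).const_sub t₀).rpow_const (Or.inl (sub_pos.2 hτ).ne')
    have hp : ∀ τ < t₀, 0 < (t₀ - τ) ^ α := fun τ hτ => Real.rpow_pos_of_pos (sub_pos.2 hτ) _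
    have := intervalIntegral.integral_le_sub_of_hasDeriv_right_of_le (a := 0) (b := s)
      (g := fun τ => z τ / (t₀ - τ) ^ α) (φ := fun τ => z' τ / (t₀ - τ) ^ α)
      (g' := fun τ => (z' τ * (t₀ - τ) ^ α - z τ * (-1 * α * (t₀ - τ) ^ (α - 1)))
        / ((t₀ - τ) ^ α) ^ 2) hs.1.le ?_ ?_ ?_ ?_
    · simpa using this
    · refine (hc.mono (Set.Icc_subset_Icc_right hs.2.le)).div
        (fun τ hτ => (hk τ (hτ.2.trans_lt hs.2)).continuousAt.continuousWithinAt)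
        (fun τ hτ => (hp τ (hτ.2.trans_lt hs.2)).ne')
    · intro τ hτ
      have hτ' := hτ.2.trans hs.2
      exact ((hd τ ⟨hτ.1, hτ'⟩).div (hk τ hτ') (hp τ hτ').ne').hasDerivWithinAt
    · rw [integrableOn_Icc_iff_integrableOn_Ioc]
      exact ((intervalIntegrable_iff_integrableOn_Ioc_of_le ht₀.le).1 hi).mono_set
        (Set.Ioc_subset_Ioc_right hs.2.le)
    · intro τ hτ
      have hτ' := hτ.2.trans hs.2
      have h0 := hz τ ⟨hτ.1, hτ'⟩
      have h1 := hp τ hτ'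
      have h2 : 0 < (t₀ - τ) ^ (α - 1) := Real.rpow_pos_of_pos (sub_pos.2 hτ') _
      rw [div_le_div_iff₀ h1 (by positivity)]
      have : 0 ≤ z τ * (α * (t₀ - τ) ^ (α - 1)) * (t₀ - τ) ^ α := by positivity
      nlinarith
  have hmem : Set.Ioo 0 t₀ ∈ 𝓝[<] t₀ := Ioo_mem_nhdsLT ht₀
  have hlim : Tendsto (fun s => ∫ τ in 0..s, z' τ / (t₀ - τ) ^ α) (𝓝[<] t₀)
      (𝓝 (∫ τ in 0..t₀, z' τ / (t₀ - τ) ^ α)) := by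
    have h := intervalIntegral.continuousOn_primitive_interval' hi Set.left_mem_uIcc
    rw [Set.uIcc_of_le ht₀.le] at h
    exact (h t₀ (Set.right_mem_Icc.2 ht₀.le)).mono_left
      (nhdsWithin_le_of_mem (mem_of_superset hmem Set.Ioo_subset_Icc_self))
  -- The quotient is minus the slope of `z` at `t₀` times `(t₀ - s)^(1-α)`, and `α < 1`.
  have hbd : Tendsto (fun s => z s / (t₀ - s) ^ α) (𝓝[<] t₀) (𝓝 0) := by
    have h1 : Tendsto (slope z t₀) (𝓝[<] t₀) (𝓝 (deriv z t₀)) :=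
      hd₀.hasDerivAt.tendsto_slope.mono_left (nhdsWithin_mono _ fun x hx => ne_of_lt hx)
    have h2 : Tendsto (fun s => (t₀ - s) ^ (1 - α)) (𝓝[<] t₀) (𝓝 0) := by
      have : ContinuousAt (fun s : ℝ => (t₀ - s) ^ (1 - α)) t₀ :=
        ContinuousAt.rpow_const (by fun_prop) (Or.inr (by linarith))
      have h3 := this.tendsto
      rw [sub_self, Real.zero_rpow (by linarith)] at h3
      exact h3.mono_left nhdsWithin_le_nhds
    have h3 := (h1.mul h2).neg
    rw [mul_zero, neg_zero] at h3
    refine h3.congr' ?_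
    filter_upwards [self_mem_nhdsWithin] with s hs
    have hs' : 0 < t₀ - s := sub_pos.2 hs
    rw [slope_def_field, hz₀, Real.rpow_sub hs', Real.rpow_one]
    have := (Real.rpow_pos_of_pos hs' α).ne'
    have h4 : s - t₀ ≠ 0 := by linarith
    field_simp
    ring
  have := le_of_tendsto_of_tendsto hlim (hbd.sub_const (z 0 / t₀ ^ α))
    (by filter_upwards [hmem] with s h using hs s h)
  simpa using this

theorem intervalIntegrable_sub_rpow_neg {α : ℝ} (hα₁ : α < 1) (t : ℝ) :
    IntervalIntegrable (fun τ => (t - τ) ^ (-α)) volume 0 t := by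
  have := (intervalIntegral.intervalIntegrable_rpow' (a := 0) (b := t)
    (r := -α) (by linarith)).comp_sub_left t
  simpa using this.symm

theorem integral_sub_rpow_neg {α t : ℝ} (hα₁ : α < 1) :
    ∫ τ in 0..t, (t - τ) ^ (-α) = t ^ (1 - α) / (1 - α) := by
  rw [intervalIntegral.integral_comp_sub_left (fun x => x ^ (-α)) t, sub_self, sub_zero,
    integral_rpow (Or.inl (by linarith)), neg_add_eq_sub, Real.zero_rpow (by linarith), sub_zero]

theorem continuousOn_const_div_sub_sq (b T t : ℝ) (hT : t < T) (ht : 0 ≤ t) :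
    ContinuousOn (fun τ => b / (T - τ) ^ 2) (Set.uIcc 0 t) := by
  refine ContinuousOn.div (by fun_prop) (by fun_prop) fun τ hτ => ?_
  rw [Set.uIcc_of_le ht] at hτ
  exact pow_ne_zero _ (by linarith [hτ.2])

theorem intervalIntegrable_const_div_sub_sq_div_rpow {α b T t : ℝ} (hα₁ : α < 1) (ht : 0 ≤ t)
    (hT : t < T) :
    IntervalIntegrable (fun τ => b / (T - τ) ^ 2 / (t - τ) ^ α) volume 0 t := by
  refine ((intervalIntegrable_sub_rpow_neg hα₁ t).continuousOn_mul
    (continuousOn_const_div_sub_sq b T t hT ht)).congr fun τ hτ => ?_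
  rw [Set.uIoc_of_le ht] at hτ
  simp only [Real.rpow_neg (sub_nonneg.2 hτ.2), div_eq_mul_inv]

theorem integral_const_div_sub_sq_div_rpow_le {α b T t : ℝ} (hα₁ : α < 1) (hb : 0 ≤ b)
    (ht : 0 ≤ t) (hT : t < T) :
    ∫ τ in 0..t, b / (T - τ) ^ 2 / (t - τ) ^ α
      ≤ b / (T - t) ^ 2 * (t ^ (1 - α) / (1 - α)) := by
  rw [← integral_sub_rpow_neg hα₁, ← intervalIntegral.integral_const_mul]
  refine intervalIntegral.integral_mono_on ht
    (intervalIntegrable_const_div_sub_sq_div_rpow hα₁ ht hT)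
    ((intervalIntegrable_sub_rpow_neg hα₁ t).const_mul _) fun τ hτ => ?_
  have h1 : 0 < T - t := sub_pos.2 hT
  have h2 : T - t ≤ T - τ := by linarith [hτ.2]
  have h3 := sub_nonneg.2 hτ.2
  rw [Real.rpow_neg h3, div_eq_mul_inv _ ((t - τ) ^ α)]
  gcongr

/-- A solution of the Caputo equation `D^α v = v²`, `v 0 = 1` cannot be continued beyond
`Γ(2-α)^(-1/α)`, by comparison with a multiple of `t ↦ 1 / (T - t)`. -/
theorem false_of_caputoDeriv_eq_sq {α T : ℝ} {v : ℝ → ℝ} (hα₀ : 0 < α) (hα₁ : α < 1)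
    (hT : (1 / Real.Gamma (2 - α)) ^ (1 / α) < T) (h0 : v 0 = 1)
    (hc : ContinuousOn v (Set.Icc 0 T)) (hd : ∀ t ∈ Set.Ioo 0 T, DifferentiableAt ℝ v t)
    (hi : ∀ t ∈ Set.Ioo 0 T,
      IntervalIntegrable (fun τ => deriv v τ / (t - τ) ^ α) volume 0 t)
    (he : ∀ t ∈ Set.Ioo 0 T, caputoDeriv α 0 v t = v t ^ 2) : False := by
  have hΓ : 0 < Real.Gamma (2 - α) := Real.Gamma_pos_of_pos (by linarith)
  have hΓ₁ : 0 < Real.Gamma (1 - α) := Real.Gamma_pos_of_pos (by linarith)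
  have hΓe : Real.Gamma (2 - α) = (1 - α) * Real.Gamma (1 - α) := by
    rw [← Real.Gamma_add_one (by linarith)]; congr 1; ring
  have hα₂ : 0 < 1 - α := by linarith
  have hT₀ : 0 < T := (Real.rpow_pos_of_pos (by positivity) _).trans hT
  have hTα : 0 < T ^ α := Real.rpow_pos_of_pos hT₀ _
  -- This `c` turns the bound for `D^α w`, with `t^(1-α)` replaced by `T^(1-α)`, into exactly `w²`;
  -- `c < 1` is the assumption on `T`.
  obtain ⟨c, hcdef⟩ : ∃ c, c = 1 / (T ^ α * Real.Gamma (2 - α)) := ⟨_, rfl⟩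
  have hc₀ : 0 < c := by rw [hcdef]; positivity
  have hc₁ : c < 1 := by
    have h := Real.rpow_lt_rpow (by positivity) hT hα₀
    rw [← Real.rpow_mul (by positivity), one_div_mul_cancel hα₀.ne', Real.rpow_one,
      div_lt_iff₀ hΓ] at h
    rw [hcdef, div_lt_one (by positivity)]
    exact h
  let w : ℝ → ℝ := fun t => c * T / (T - t)
  have hw : ∀ t < T, HasDerivAt w (c * T / (T - t) ^ 2) t := by
    intro t ht
    have h1 : T - t ≠ 0 := by linarith
    have := (hasDerivAt_const t (c * T)).div ((hasDerivAt_id t).const_sub T) h1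
    refine this.congr_deriv ?_
    simp
  -- `t₁` solves `w t₁ = max M 1` for an upper bound `M` of `v`; the level exceeds `c = w 0`, so `t₁
  -- > 0`.
  obtain ⟨t₁, ht₁, hvw⟩ : ∃ t₁ ∈ Set.Ioo 0 T, v t₁ ≤ w t₁ := by
    obtain ⟨M, hM⟩ := (isCompact_Icc.image_of_continuousOn hc).bddAbove
    have hM₁ : c < max M 1 := hc₁.trans_le (le_max_right _ _)
    have hM₀ := hc₀.trans hM₁
    have h1 : c * T / max M 1 < T := by
      rw [div_lt_iff₀ hM₀, mul_comm T]; gcongr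
    have h2 : 0 < c * T / max M 1 := by positivity
    refine ⟨T - c * T / max M 1, ⟨by linarith, by linarith⟩, ?_⟩
    have h3 : w (T - c * T / max M 1) = max M 1 := by
      simp only [w, sub_sub_cancel]
      field_simp
    rw [h3]
    exact (hM (Set.mem_image_of_mem v ⟨by linarith, by linarith⟩)).trans (le_max_left _ _)
  let z : ℝ → ℝ := fun t => v t - w t
  have hz : ContinuousOn z (Set.Icc 0 t₁) :=
    (hc.mono (Set.Icc_subset_Icc_right ht₁.2.le)).sub
      fun t ht => (hw t (ht.2.trans_lt ht₁.2)).continuousAt.continuousWithinAt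
  have hz0 : 0 < z 0 := by
    simp only [z, w, h0, sub_zero]
    rw [mul_div_cancel_right₀ _ hT₀.ne']
    linarith
  -- The least element of this set is the first contact time of `v` and `w`.
  have hS : IsCompact (Set.Icc 0 t₁ ∩ z ⁻¹' Set.Iic 0) :=
    isCompact_Icc.of_isClosed_subset (hz.preimage_isClosed_of_isClosed isClosed_Icc isClosed_Iic)
      Set.inter_subset_left
  obtain ⟨t₀, ⟨ht₀, hzt⟩, hmin⟩ :=
    hS.exists_isLeast ⟨t₁, Set.right_mem_Icc.2 ht₁.1.le, sub_nonpos.2 hvw⟩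
  have hpos : 0 < t₀ := by
    refine lt_of_le_of_ne ht₀.1 fun h => ?_
    rw [← h] at hzt
    exact (not_le.2 hz0) hzt
  have hlt : t₀ < T := ht₀.2.trans_lt ht₁.2
  have hbefore : ∀ t ∈ Set.Ioo 0 t₀, 0 ≤ z t := by
    intro t ht
    by_contra! h
    exact (not_le.2 ht.2) (hmin ⟨⟨ht.1.le, ht.2.le.trans ht₀.2⟩, h.le⟩)
  have hmemT : t₀ ∈ Set.Ioo 0 T := ⟨hpos, hlt⟩
  have hdz : ∀ t ∈ Set.Ioo 0 T, HasDerivAt z (deriv v t - c * T / (T - t) ^ 2) t :=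
    fun t ht => (hd t ht).hasDerivAt.sub (hw t ht.2)
  have hzt₀ : z t₀ = 0 := by
    refine le_antisymm hzt (ge_of_tendsto
      ((hdz t₀ hmemT).continuousAt.tendsto.mono_left (nhdsWithin_le_nhds (s := Set.Iio t₀))) ?_)
    filter_upwards [Ioo_mem_nhdsLT hpos] with t ht using hbefore t ht
  have hiw := intervalIntegrable_const_div_sub_sq_div_rpow (b := c * T) hα₁ hpos.le hlt
  have key := integral_deriv_div_rpow_le hα₀ hα₁ hpos
    (hz.mono (Set.Icc_subset_Icc_right ht₀.2))
    (fun t ht => hdz t ⟨ht.1, ht.2.trans hlt⟩) (hdz t₀ hmemT).differentiableAt hbefore hzt₀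
    (by simpa only [sub_div] using (hi t₀ hmemT).sub hiw)
  simp only [sub_div] at key
  rw [intervalIntegral.integral_sub (hi t₀ hmemT) hiw] at key
  have hneg : 0 < z 0 / t₀ ^ α := div_pos hz0 (Real.rpow_pos_of_pos hpos _)
  have hI : ∫ τ in 0..t₀, deriv v τ / (t₀ - τ) ^ α = Real.Gamma (1 - α) * w t₀ ^ 2 := by
    have h := he t₀ hmemT
    rw [caputoDeriv, sub_eq_zero.1 hzt₀] at h
    rw [← h]
    field_simp
  have hJ := integral_const_div_sub_sq_div_rpow_le (b := c * T) hα₁ (by positivity) hpos.le hlt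
  have hK : c * T / (T - t₀) ^ 2 * (t₀ ^ (1 - α) / (1 - α)) ≤ Real.Gamma (1 - α) * w t₀ ^ 2 := by
    have hTt : 0 < T - t₀ := sub_pos.2 hlt
    calc c * T / (T - t₀) ^ 2 * (t₀ ^ (1 - α) / (1 - α))
        ≤ c * T / (T - t₀) ^ 2 * (T ^ (1 - α) / (1 - α)) := by gcongr
      _ = Real.Gamma (1 - α) * w t₀ ^ 2 := by
        simp only [w]
        rw [Real.rpow_sub hT₀, Real.rpow_one, hcdef, hΓe]
        field_simp
  linarith

theorem theorem2 (α : ℝ) (hα₀ : 0 < α) (hα₁ : α < 1) (Tstar : EReal) (v : ℝ → ℝ)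
    (hv : IsSingularSolutionWithBlowUpTime α Tstar v) :
    Tstar ≤ (((1 / Real.Gamma (2 - α)) ^ (1 / α) : ℝ) : EReal) ∧
      Tstar ≤ ((Real.exp (1 - Real.eulerMascheroniConstant) : ℝ) : EReal) ∧
      (1.52620511 : ℝ) ≤ Real.exp (1 - Real.eulerMascheroniConstant) ∧
      Real.exp (1 - Real.eulerMascheroniConstant) < (1.52620512 : ℝ) := by
  have hbound : Tstar ≤ (((1 / Real.Gamma (2 - α)) ^ (1 / α) : ℝ) : EReal) := by
    by_contra! h
    obtain ⟨T, hT, hTs⟩ := EReal.lt_iff_exists_real_btwn.1 h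
    have hs := hv.solution
    -- The slice `x = -1` is `v` itself.
    have hu : (fun t => -(-1 : ℝ) * v t) = v := by ext t; ring
    have hin : ∀ t : ℝ, t ≤ T → (t : EReal) < Tstar :=
      fun t ht => (EReal.coe_le_coe_iff.2 ht).trans_lt hTs
    refine false_of_caputoDeriv_eq_sq (v := v) hα₀ hα₁ (EReal.coe_lt_coe_iff.1 hT) ?_ ?_ ?_ ?_ ?_
    · simpa using hs.initial (-1)
    · have := hs.continuous_time (-1)
      rw [hu] at this
      exact this.mono fun t ht => ⟨ht.1, hin t ht.2⟩
    · intro t ht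
      have := hs.differentiable_time (-1) t ht.1 (hin t ht.2.le)
      rwa [hu] at this
    · intro t ht
      have := hs.integrable_memory (-1) t ht.1 (hin t ht.2.le)
      rwa [hu] at this
    · intro t ht
      have h1 := hs.equation (-1) t ht.1 (hin t ht.2.le)
      have h2 : deriv (fun y : ℝ => -y * v t) (-1) = -v t := by
        simp
      rw [hu, h2] at h1
      linarith
  exact ⟨hbound, hbound.trans (EReal.coe_le_coe_iff.2 (rpow_inv_Gamma_two_sub_le_exp hα₀ hα₁)),
    exp_one_sub_eulerMascheroniConstant_mem.1, exp_one_sub_eulerMascheroniConstant_mem.2⟩
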